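/- **Theorem (existence and uniqueness of the UHEC).** Let $H=(V,E)$ be a finite hypergraph: $V$ is a finite set of nodes and $E$ is a finite, nonempty set of nonempty hyperedges, each hyperedge being a finite set (or, more generally, multiset) of nodes; the size $|e|$ of a hyperedge counts multiplicity. Suppose that $H$ is strongly connected, i.e. $V\neq\emptyset$ and any two nodes are joined by a walk whose consecutive nodes lie in a common hyperedge. Let $M$ be the maximum hyperedge size of $H$ and let $m\ge M$. The *uplift* $\widetilde H=(\widetilde V,\widetilde E)$ of $H$ to order $m$ is obtained by adding an auxiliary node $\star\notin V$ exactly $m-|e|$ times to each $e\in E$; here $\widetilde V=V\cup\{\star\}$ if some hyperedge has size $<m$, and $\widetilde V=V$ (so $\widetilde H=H$) if all hyperedges have size $m$. The *uplifted tensor* $\widetilde T$ has, for $i_1,\dots,i_m\in\widetilde V$, the entries $$\widetilde T_{i_1\cdots i_m}=\begin{cases}1 & \{i_1,\dots,i_m\}\in E,\\ w_m(m^\star) & \{i_1,\dots,i_m\}\in\widetilde E\setminus E,\\ 0&\text{otherwise,}\end{cases}$$ where $\{i_1,\dots,i_m\}$ is read as a multiset, $m^\star$ is the multiplicity of $\star$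 in it, and the weight is either $w_m(m^\star)=\dfrac{m^\star\,(m-m^\star)!}{m!}$ or $w_m(m^\star)=\dfrac{m^\star!\,(m-m^\star)!}{m!}$ (the same choice for all entries; the theorem holds for both). An *$\mathcal H$-eigenvector centrality* (HEC) of $\widetilde H$ is a vector $c\in\mathbb R^{\widetilde V}$ with all entries positive such that, for some real $\lambda\neq0$, $$\lambda\,c_{i}^{\,m-1}=\sum_{i_2,\dots,i_m\in\widetilde V}\widetilde T_{i\,i_2\cdots i_m}\,c_{i_2}\cdots c_{i_m}\qquad\text{for all } i\in\widetilde V .$$ An *$m$-UHEC* of $H$ is the restriction to $V$ of an HEC of $\widetilde H$. Then $H$ has an $m$-UHEC $u\in\mathbb R^{V}$; it is entrywise positive, and it is unique up to scaling: a vector $u'\in\mathbb R^V$ is an $m$-UHEC of $H$ if and only if $u'=a\,u$ for some real $a>0$. -/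

import Mathlib

open scoped Nat

/-- A finite hypergraph with nodes in the ambient type `α`: a finite set of nodes and a finite set
of nonempty hyperedges. A hyperedge is a multiset of nodes (an ordinary set of nodes is a multiset
without repetitions), and its size is its cardinality counted with multiplicity. -/
structure MHypergraph (α : Type*) where
  verts : Finset α
  edges : Finset (Multiset α)
  mem_verts : ∀ e ∈ edges, ∀ v ∈ e, v ∈ verts
  edge_ne_zero : ∀ e ∈ edges, e ≠ 0

namespace MHypergraph

/-- Any two nodes are joined by a walk in which consecutive nodes share a hyperedge. -/
def StronglyConnected {α : Type*} (H : MHypergraph α) : Prop :=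
  H.verts.Nonempty ∧
    ∀ u ∈ H.verts, ∀ v ∈ H.verts,
      Relation.ReflTransGen (fun a b => ∃ e ∈ H.edges, a ∈ e ∧ b ∈ e) u v

/-- `M` is the maximum hyperedge size of `H` (so `H` has at least one hyperedge). -/
def IsMaxEdgeSize {α : Type*} (H : MHypergraph α) (M : ℕ) : Prop :=
  IsGreatest {k : ℕ | ∃ e ∈ H.edges, e.card = k} M

/-- The hyperedge `e` filled up to size `m` with copies of the auxiliary node `none`. -/
def upliftEdge {α : Type*} (m : ℕ) (e : Multiset α) : Multiset (Option α) :=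
  e.map some + Multiset.replicate (m - e.card) none

/-- The uplift of `H` to order `m`. The auxiliary node `⋆` is `none : Option α`; the nodes of `H`
are `some v`. The auxiliary node belongs to the uplift exactly when it is added to some hyperedge,
so that an `m`-uniform hypergraph is its own uplift to order `m`. -/
def uplift {α : Type*} [DecidableEq α] (H : MHypergraph α) (m : ℕ) : MHypergraph (Option α) where
  verts := if ∃ e ∈ H.edges, e.card < m then Finset.insertNone H.verts
    else H.verts.map Function.Embedding.some
  edges := H.edges.image (upliftEdge m)
  mem_verts := by
    intro f hf v hv
    obtain ⟨e, he, rfl⟩ := Finset.mem_image.1 hf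
    rcases Multiset.mem_add.1 hv with h | h
    · obtain ⟨a, ha, rfl⟩ := Multiset.mem_map.1 h
      have := H.mem_verts e he a ha
      split_ifs <;> simpa using this
    · rw [Multiset.mem_replicate] at h
      have h1 : ∃ e ∈ H.edges, e.card < m := ⟨e, he, by omega⟩
      rw [if_pos h1, h.2]
      simp
  edge_ne_zero := by
    intro f hf h0
    obtain ⟨e, he, rfl⟩ := Finset.mem_image.1 hf
    rw [upliftEdge, add_eq_zero, Multiset.map_eq_zero] at h0
    exact H.edge_ne_zero e he h0.1

theorem some_mem_uplift_verts {α : Type*} [DecidableEq α] (H : MHypergraph α) (m : ℕ)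
    (v : H.verts) : some (v : α) ∈ (H.uplift m).verts := by
  have := v.2
  unfold uplift
  dsimp only
  split_ifs <;> simp

end MHypergraph

/-- A real tensor (hypermatrix) of order `m` with indices in `ι`. -/
abbrev OrderTensor (m : ℕ) (ι : Type*) := (Fin m → ι) → ℝ

/-- The index tuple `(i, j₁, …, j_{m-1})`. -/
def prependIndex {ι : Type*} {m : ℕ} (i : ι) (j : Fin (m - 1) → ι) : Fin m → ι :=
  fun l => if h : l.val = 0 then i else j ⟨l.val - 1, by omega⟩

/-- The vector `T c^{m-1}`, whose `i`-th entry is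
`∑ T_{i j₁ … j_{m-1}} c_{j₁} ⋯ c_{j_{m-1}}`, summed over all `j₁, …, j_{m-1}`. -/
noncomputable def tensorApply {ι : Type*} [Fintype ι] {m : ℕ} (T : OrderTensor m ι)
    (c : ι → ℝ) (i : ι) : ℝ :=
  ∑ j : Fin (m - 1) → ι, T (prependIndex i j) * ∏ l, c (j l)

/-- `c` is an `H`-eigenvector centrality of the order-`m` tensor `T`: it is entrywise positive and
`c_i^{m-1} = (1/μ) (T c^{m-1})_i` for all `i`, for some `μ ≠ 0`. -/
def IsHEC {ι : Type*} [Fintype ι] {m : ℕ} (T : OrderTensor m ι) (c : ι → ℝ) : Prop :=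
  (∀ i, 0 < c i) ∧ ∃ μ : ℝ, μ ≠ 0 ∧ ∀ i, μ * c i ^ (m - 1) = tensorApply T c i

/-- The weight `s (m - s)! / m!`, for order `m` and `s` copies of the auxiliary node. -/
noncomputable def linearWeight (m s : ℕ) : ℝ := (s : ℝ) * ((m - s)! : ℝ) / (m ! : ℝ)

/-- The weight `s! (m - s)! / m!`, for order `m` and `s` copies of the auxiliary node. -/
noncomputable def factorialWeight (m s : ℕ) : ℝ := (s ! : ℝ) * ((m - s)! : ℝ) / (m ! : ℝ)

namespace MHypergraph

/-- The multiset `{i₁, …, i_m}` of the entries of a tuple of nodes. -/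
def indexMultiset {β : Type*} {W : Finset β} {m : ℕ} (i : Fin m → W) : Multiset β :=
  Finset.univ.val.map fun l => (i l : β)

/-- The uplifted tensor of `H` at order `m`: the entry at `(i₁, …, i_m)` is `1` if
`{i₁, …, i_m}` is a hyperedge of `H`, it is `w m s` if `{i₁, …, i_m}` is another hyperedge of the
uplift and contains the auxiliary node `s` times, and it is `0` otherwise. -/
noncomputable def upliftTensor {α : Type*} [DecidableEq α] (H : MHypergraph α)
    (w : ℕ → ℕ → ℝ) (m : ℕ) : OrderTensor m (H.uplift m).verts := fun i =>
  if indexMultiset i ∈ H.edges.image (Multiset.map some) then 1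
  else if indexMultiset i ∈ (H.uplift m).edges then w m ((indexMultiset i).count none)
  else 0

/-- `u` is an `m`-UHEC of `H`: the vector of those components of an `H`-eigenvector centrality of
the uplift of `H` to order `m` that belong to nodes of `H`. -/
def IsUHEC {α : Type*} [DecidableEq α] (H : MHypergraph α) (w : ℕ → ℕ → ℝ) (m : ℕ)
    (u : H.verts → ℝ) : Prop :=
  ∃ c : (H.uplift m).verts → ℝ, IsHEC (H.upliftTensor w m) c ∧
    ∀ v : H.verts, u v = c ⟨some (v : α), H.some_mem_uplift_verts m v⟩

end MHypergraph

/-! The proof is variational Perron–Frobenius theory for a symmetric nonnegative tensor `T` of order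
`m = n + 1` whose indices are connected by `TensorLinked`; the uplifted tensor of a strongly
connected hypergraph is of this kind.

Existence: the form `F(x) = ∑ T_I x_{i₁} ⋯ x_{i_m}` attains its maximum on the compact set `x ≥ 0`,
`∑ x_i ^ m = 1`. Connectedness makes every maximizer positive (`maximizer_pos`), so the constraint
`x ≥ 0` is inactive. By symmetry the gradient of `F` is `m` times `tensorApply T x`, and that of `∑
x_i ^ m` is `m x_i ^ (m - 1)`; the Lagrange condition is therefore the eigenvector equation, with
the maximum as eigenvalue (`exists_isHEC`).

Uniqueness: given positive eigenvectors `c` and `d`, scale `c` until it lies above `d` and touches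
it. Monotonicity at the touching index forces equal eigenvalues, and then equality spreads along
links to all indices (`eq_of_tensorApply_eq`). -/

section NonnegativeTensor

variable {ι : Type*} {n : ℕ}

/-- Two indices are linked if they both occur in the index tuple of a positive entry. -/
def TensorLinked {m : ℕ} (T : OrderTensor m ι) (a b : ι) : Prop :=
  ∃ I : Fin m → ι, 0 < T I ∧ (∃ k, I k = a) ∧ ∃ l, I l = b

theorem TensorLinked.symm {m : ℕ} {T : OrderTensor m ι} {a b : ι} (h : TensorLinked T a b) :
    TensorLinked T b a :=
  let ⟨I, hI, ha, hb⟩ := h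
  ⟨I, hI, hb, ha⟩

theorem prependIndex_eq_cons (i : ι) (j : Fin n → ι) :
    prependIndex (m := n + 1) i j = Fin.cons i j := by
  funext l
  refine Fin.cases ?_ (fun k => ?_) l <;> simp [prependIndex]

/-- Used with `p` the support of a maximizer: if the support were proper, some positive tensor entry
would straddle its boundary. -/
theorem Relation.ReflTransGen.exists_crossing {r : ι → ι → Prop} {p : ι → Prop} {a b : ι}
    (h : Relation.ReflTransGen r a b) (ha : p a) (hb : ¬ p b) :
    ∃ u v, r u v ∧ p u ∧ ¬ p v := by
  induction h with
  | refl => exact absurd ha hb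
  | @tail c d _ hr ih =>
    by_cases hc : p c
    · exact ⟨c, d, hr, hc, hb⟩
    · exact ih hc

/-! ### The form of a tensor and its gradient. -/

variable [Fintype ι]

/-- The homogeneous form `∑ T_{i₁ … i_m} x_{i₁} ⋯ x_{i_m}` of a tensor. -/
noncomputable def tensorForm {m : ℕ} (T : OrderTensor m ι) (x : ι → ℝ) : ℝ :=
  ∑ I : Fin m → ι, T I * ∏ l, x (I l)

theorem tensorApply_eq_sum_cons (T : OrderTensor (n + 1) ι) (c : ι → ℝ) (i : ι) :
    tensorApply T c i = ∑ j : Fin n → ι, T (Fin.cons i j) * ∏ l, c (j l) :=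
  Finset.sum_congr rfl fun j _ => by
    rw [← prependIndex_eq_cons]; rfl

theorem tensorForm_smul {m : ℕ} (T : OrderTensor m ι) (a : ℝ) (x : ι → ℝ) :
    tensorForm T (a • x) = a ^ m * tensorForm T x := by
  simp only [tensorForm, Finset.mul_sum, Pi.smul_apply, smul_eq_mul, Finset.prod_mul_distrib,
    Finset.prod_const, Finset.card_univ, Fintype.card_fin]
  exact Finset.sum_congr rfl fun I _ => by ring

theorem tensorApply_smul (T : OrderTensor (n + 1) ι) (a : ℝ) (x : ι → ℝ) (i : ι) :
    tensorApply T (a • x) i = a ^ n * tensorApply T x i := by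
  simp only [tensorApply_eq_sum_cons, Finset.mul_sum, Pi.smul_apply, smul_eq_mul,
    Finset.prod_mul_distrib, Finset.prod_const, Finset.card_univ, Fintype.card_fin]
  exact Finset.sum_congr rfl fun I _ => by ring

theorem IsHEC.smul {T : OrderTensor (n + 1) ι} {c : ι → ℝ} (hc : IsHEC T c) {a : ℝ}
    (ha : 0 < a) : IsHEC T (a • c) := by
  obtain ⟨hpos, μ, hμ, h⟩ := hc
  refine ⟨fun i => mul_pos ha (hpos i), μ, hμ, fun i => ?_⟩
  have hi : μ * c i ^ n = tensorApply T c i := h i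
  rw [tensorApply_smul, ← hi]
  simp only [Pi.smul_apply, smul_eq_mul, Nat.add_sub_cancel, mul_pow]
  ring

/-- The partial derivatives of the form of a symmetric tensor. -/
theorem hasDerivAt_tensorForm [DecidableEq ι] {T : OrderTensor (n + 1) ι}
    (hsymm : ∀ (I : Fin (n + 1) → ι) (σ : Equiv.Perm (Fin (n + 1))), T (I ∘ σ) = T I)
    (x : ι → ℝ) (i : ι) :
    HasDerivAt (fun t : ℝ => tensorForm T (x + t • Pi.single i 1))
      ((n + 1 : ℕ) * tensorApply T x i) 0 := by
  have h1 : ∀ j, HasDerivAt (fun t : ℝ => (x + t • (Pi.single i 1 : ι → ℝ)) j)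
      ((Pi.single i 1 : ι → ℝ) j) 0 := fun j => by
    simpa using ((hasDerivAt_id (0 : ℝ)).mul_const ((Pi.single i 1 : ι → ℝ) j)).const_add (x j)
  have h2 := HasDerivAt.fun_sum (u := Finset.univ) fun (I : Fin (n + 1) → ι) _ =>
    (HasDerivAt.fun_finsetProd (u := Finset.univ) fun l _ => h1 (I l)).const_mul (T I)
  refine h2.congr_deriv ?_
  simp only [zero_smul, add_zero, smul_eq_mul, Finset.mul_sum]
  rw [Finset.sum_comm]
  -- By symmetry, the slot being differentiated can be cycled to the front, so all `n + 1` slots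
  -- contribute the same amount.
  have key : ∀ l : Fin (n + 1), ∑ I : Fin (n + 1) → ι,
      T I * ((∏ k ∈ Finset.univ.erase l, x (I k)) * (Pi.single i 1 : ι → ℝ) (I l)) =
        tensorApply T x i := by
    intro l
    rw [← (Fin.insertNthEquiv (fun _ => ι) l).sum_comp, Fintype.sum_prod_type,
      Finset.sum_eq_single i, tensorApply_eq_sum_cons]
    · refine Finset.sum_congr rfl fun j _ => ?_
      have herase : ∏ k ∈ Finset.univ.erase l, x (l.insertNth (α := fun _ => ι) i j k) =
          ∏ k, x (j k) := by
        have : Finset.univ.erase l = Finset.univ.map l.succAboveEmb := by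
          ext k
          simp [Fin.exists_succAbove_eq_iff]
        rw [this, Finset.prod_map]
        simp
      have hI : Fin.insertNthEquiv (fun _ => ι) l (i, j) =
          (Fin.cons i j : Fin (n + 1) → ι) ∘ l.cycleRange :=
        (Fin.cons_comp_cycleRange i j l).symm
      rw [show ∏ k ∈ Finset.univ.erase l, x (Fin.insertNthEquiv (fun _ => ι) l (i, j) k) =
        ∏ k, x (j k) from herase, hI, hsymm]
      simp
    · intro b _ hb
      simp [Pi.single_eq_of_ne hb]
    · simp
  rw [Finset.sum_congr rfl fun l _ => key l]
  simp

/-! ### Existence of a positive eigenvector. -/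

/-- A nonnegative, nonzero maximizer of the form relative to `∑ x_i ^ m`. -/
theorem exists_tensorForm_maximizer [Nonempty ι] (T : OrderTensor (n + 1) ι) :
    ∃ x : ι → ℝ, (∀ i, 0 ≤ x i) ∧ ∑ i, x i ^ (n + 1) = 1 ∧
      ∀ z : ι → ℝ, (∀ i, 0 ≤ z i) →
        tensorForm T z ≤ tensorForm T x * ∑ i, z i ^ (n + 1) := by
  classical
  let K : Set (ι → ℝ) := {x | (∀ i, 0 ≤ x i) ∧ ∑ i, x i ^ (n + 1) = 1}
  have hKsub : K ⊆ Set.Icc 0 1 := by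
    rintro x ⟨hx, hs⟩
    refine ⟨hx, fun i => ?_⟩
    have : x i ^ (n + 1) ≤ 1 := by
      rw [← hs]
      exact Finset.single_le_sum (f := fun i => x i ^ (n + 1))
        (fun j _ => pow_nonneg (hx j) _) (Finset.mem_univ i)
    exact (pow_le_one_iff_of_nonneg (hx i) n.succ_ne_zero).1 this
  have hKclosed : IsClosed K := by
    have h1 : IsClosed {x : ι → ℝ | ∀ i, 0 ≤ x i} := by
      simp only [Set.ofPred_forall]
      exact isClosed_iInter fun i => isClosed_le continuous_const (continuous_apply i)
    exact h1.inter (isClosed_eq (by fun_prop) continuous_const)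
  have hK : IsCompact K := isCompact_Icc.of_isClosed_subset hKclosed hKsub
  have hne : K.Nonempty := by
    obtain ⟨i⟩ := ‹Nonempty ι›
    refine ⟨Pi.single i 1, fun j => ?_, ?_⟩
    · by_cases h : j = i <;> simp [h]
    · rw [Finset.sum_eq_single i] <;> simp +contextual
  have hcont : Continuous (tensorForm T) := by
    unfold tensorForm
    fun_prop
  obtain ⟨x, hxK, hx⟩ := hK.exists_isMaxOn hne hcont.continuousOn
  refine ⟨x, hxK.1, hxK.2, fun z hz => ?_⟩
  set s := ∑ i, z i ^ (n + 1) with hs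
  have hs0 : 0 ≤ s := Finset.sum_nonneg fun i _ => pow_nonneg (hz i) _
  rcases hs0.eq_or_lt with h0 | hpos
  · have hz0 : z = 0 := by
      funext i
      have := (Finset.sum_eq_zero_iff_of_nonneg fun i _ => pow_nonneg (hz i) (n + 1)).1
        (hs.symm.trans h0.symm) i (Finset.mem_univ i)
      exact pow_eq_zero_iff n.succ_ne_zero |>.1 this
    rw [← h0, hz0]
    simp [tensorForm]
  -- Both sides are homogeneous of degree `n + 1`, so `z` may be rescaled into `K`.
  · set r : ℝ := s ^ (((n + 1 : ℕ) : ℝ)⁻¹) with hr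
    have hrpos : 0 < r := Real.rpow_pos_of_pos hpos _
    have hrs : r ^ (n + 1) = s := Real.rpow_inv_natCast_pow hs0 n.succ_ne_zero
    have hmem : r⁻¹ • z ∈ K := by
      refine ⟨fun i => mul_nonneg (inv_nonneg.2 hrpos.le) (hz i), ?_⟩
      simp only [Pi.smul_apply, smul_eq_mul, mul_pow]
      rw [← Finset.mul_sum, ← hs, inv_pow, hrs, inv_mul_cancel₀ hpos.ne']
    have h : tensorForm T (r⁻¹ • z) ≤ tensorForm T x := hx hmem
    rw [tensorForm_smul, inv_pow, hrs, inv_mul_le_iff₀ hpos] at h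
    linarith [mul_comm s (tensorForm T x)]

/-- A maximizer of the form of a connected tensor has no zero entry. -/
theorem maximizer_pos {T : OrderTensor (n + 1) ι} (hT : ∀ I, 0 ≤ T I)
    (hconn : ∀ a b, Relation.ReflTransGen (TensorLinked T) a b) {x : ι → ℝ}
    (hx : ∀ i, 0 ≤ x i) (hsum : ∑ i, x i ^ (n + 1) = 1)
    (hmax : ∀ z : ι → ℝ, (∀ i, 0 ≤ z i) →
      tensorForm T z ≤ tensorForm T x * ∑ i, z i ^ (n + 1)) (i : ι) : 0 < x i := by
  classical
  by_contra hi
  obtain ⟨a, ha⟩ : ∃ a, 0 < x a := by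
    by_contra! h
    have : ∀ i, x i = 0 := fun i => le_antisymm (h i) (hx i)
    simp [this] at hsum
  obtain ⟨u, v, ⟨I, hI, ⟨k, hk⟩, ⟨l, hl⟩⟩, hu, hv⟩ :=
    (hconn a i).exists_crossing (p := fun i => 0 < x i) ha hi
  have hv0 : x v = 0 := le_antisymm (not_lt.1 hv) (hx v)
  -- Replacing zeros by `ε` gains at least `T I * x u * ε ^ n` in the form, while the normalization
  -- grows by at most `card ι * ε ^ (n + 1)`. The gain has lower order in `ε`, so it wins for small
  -- `ε`.
  have hev : ∀ᶠ ε in nhdsWithin (0 : ℝ) (Set.Ioi 0), 0 < ε ∧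
      tensorForm T x * (Fintype.card ι * ε) < T I * x u ∧ ∀ j, 0 < x j → ε < x j := by
    refine Filter.Eventually.and self_mem_nhdsWithin (nhdsWithin_le_nhds ?_)
    refine Filter.Eventually.and ?_ (Filter.eventually_all.2 fun j => ?_)
    · have hc : Continuous fun ε : ℝ => tensorForm T x * (Fintype.card ι * ε) := by fun_prop
      exact hc.continuousAt.eventually_lt_const (by simpa using mul_pos hI hu)
    · by_cases hj : 0 < x j
      · simpa [hj] using eventually_lt_nhds hj
      · simp [hj]
  obtain ⟨ε, hε, hsmall, hεx⟩ := hev.exists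
  -- Raising the zero entries of `x` to `ε` increases the form too much.
  let z : ι → ℝ := fun i => if 0 < x i then x i else ε
  have hzε : ∀ i, ε ≤ z i := fun i => by
    by_cases h : 0 < x i
    · simpa [z, h] using (hεx i h).le
    · simp [z, h]
  have hxz : ∀ i, x i ≤ z i := fun i => by
    by_cases h : 0 < x i
    · simp [z, h]
    · simpa [z, h] using (not_lt.1 h).trans hε.le
  have hz0 : ∀ i, 0 ≤ z i := fun i => (hx i).trans (hxz i)
  have hzu : z u = x u := if_pos hu
  have hform : tensorForm T x + T I * (x u * ε ^ n) ≤ tensorForm T z := by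
    have hsplit : tensorForm T x + T I * (x u * ε ^ n) = ∑ J : Fin (n + 1) → ι,
        (T J * ∏ p, x (J p) + if J = I then T I * (x u * ε ^ n) else 0) := by
      rw [Finset.sum_add_distrib, Finset.sum_ite_eq' Finset.univ I]
      simp [tensorForm]
    rw [hsplit]
    refine Finset.sum_le_sum fun J _ => ?_
    by_cases hJ : J = I
    · subst hJ
      rw [if_pos rfl, Finset.prod_eq_zero (Finset.mem_univ l) (by rw [hl, hv0]), mul_zero, zero_add]
      refine mul_le_mul_of_nonneg_left ?_ (hT J)
      rw [Fin.prod_univ_succAbove _ k, hk, hzu]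
      refine mul_le_mul_of_nonneg_left ?_ hu.le
      calc ε ^ n = ∏ _p : Fin n, ε := by simp
        _ ≤ _ := Finset.prod_le_prod (fun _ _ => hε.le) fun p _ => hzε _
    · rw [if_neg hJ, add_zero]
      exact mul_le_mul_of_nonneg_left
        (Finset.prod_le_prod (fun _ _ => hx _) fun _ _ => hxz _) (hT J)
  have hpow : ∑ i, z i ^ (n + 1) ≤ 1 + Fintype.card ι * ε ^ (n + 1) := by
    calc ∑ i, z i ^ (n + 1) ≤ ∑ i, (x i ^ (n + 1) + ε ^ (n + 1)) := by
          refine Finset.sum_le_sum fun i _ => ?_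
          by_cases h : 0 < x i
          · simpa [z, h] using pow_nonneg hε.le _
          · simpa [z, h] using pow_nonneg (hx i) _
      _ = _ := by simp [Finset.sum_add_distrib, hsum]
  have hlam : 0 ≤ tensorForm T x :=
    Finset.sum_nonneg fun J _ => mul_nonneg (hT J) (Finset.prod_nonneg fun _ _ => hx _)
  have h1 := hform.trans ((hmax z hz0).trans (mul_le_mul_of_nonneg_left hpow hlam))
  have h2 := mul_lt_mul_of_pos_right hsmall (pow_pos hε n)
  rw [pow_succ] at h1
  linarith

/-- A connected symmetric nonnegative tensor has a positive eigenvector. -/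
theorem exists_isHEC {T : OrderTensor (n + 1) ι} (hT : ∀ I, 0 ≤ T I)
    (hsymm : ∀ (I : Fin (n + 1) → ι) (σ : Equiv.Perm (Fin (n + 1))), T (I ∘ σ) = T I)
    (hconn : ∀ a b, Relation.ReflTransGen (TensorLinked T) a b) (hpos : ∃ I, 0 < T I) :
    ∃ c, IsHEC T c := by
  classical
  obtain ⟨I, hI⟩ := hpos
  have : Nonempty ι := ⟨I 0⟩
  obtain ⟨x, hx, hsum, hmax⟩ := exists_tensorForm_maximizer T
  have hxpos := maximizer_pos hT hconn hx hsum hmax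
  have hlam : 0 < tensorForm T x :=
    Finset.sum_pos' (fun J _ => mul_nonneg (hT J) (Finset.prod_nonneg fun _ _ => hx _))
      ⟨I, Finset.mem_univ I, mul_pos hI (Finset.prod_pos fun _ _ => hxpos _)⟩
  refine ⟨x, hxpos, tensorForm T x, hlam.ne', fun i => ?_⟩
  have h1 : ∀ j, HasDerivAt (fun t : ℝ => (x + t • (Pi.single i 1 : ι → ℝ)) j)
      ((Pi.single i 1 : ι → ℝ) j) 0 := fun j => by
    simpa using ((hasDerivAt_id (0 : ℝ)).mul_const ((Pi.single i 1 : ι → ℝ) j)).const_add (x j)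
  have h2 : HasDerivAt (fun t : ℝ => ∑ j, (x + t • (Pi.single i 1 : ι → ℝ)) j ^ (n + 1))
      ((n + 1 : ℕ) * x i ^ n) 0 := by
    refine (HasDerivAt.fun_sum (u := Finset.univ) fun j _ =>
      (h1 j).fun_pow (n + 1)).congr_deriv ?_
    rw [Finset.sum_eq_single i]
    · simp
    · intro j _ hj
      simp [Pi.single_eq_of_ne hj]
    · simp
  -- Since `x i > 0`, small steps of either sign stay in the nonnegative orthant, so the maximum is
  -- two-sided and the derivative vanishes.
  have hmaxloc : IsLocalMax (fun t : ℝ => tensorForm T (x + t • Pi.single i 1) -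
      tensorForm T x * ∑ j, (x + t • (Pi.single i 1 : ι → ℝ)) j ^ (n + 1)) 0 := by
    have hev : ∀ᶠ t : ℝ in nhds 0, -(x i) < t := eventually_gt_nhds (by simpa using hxpos i)
    filter_upwards [hev] with t ht
    have hz : ∀ j, 0 ≤ (x + t • (Pi.single i 1 : ι → ℝ)) j := fun j => by
      by_cases hj : j = i
      · subst hj
        simp only [Pi.add_apply, Pi.smul_apply, Pi.single_eq_same, smul_eq_mul, mul_one]
        linarith
      · simpa [Pi.single_eq_of_ne hj] using hx j
    have := hmax _ hz
    simp only [zero_smul, add_zero, hsum, mul_one, sub_self]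
    linarith
  have h3 := hmaxloc.hasDerivAt_eq_zero
    ((hasDerivAt_tensorForm hsymm x i).sub (h2.const_mul (tensorForm T x)))
  have hn : ((n + 1 : ℕ) : ℝ) ≠ 0 := Nat.cast_ne_zero.2 n.succ_ne_zero
  have h4 : ((n + 1 : ℕ) : ℝ) * (tensorApply T x i - tensorForm T x * x i ^ n) = 0 := by
    linarith
  have h5 := (mul_eq_zero.1 h4).resolve_left hn
  simp only [Nat.add_sub_cancel]
  linarith

/-! ### Uniqueness of positive eigenvectors. -/

theorem tensorApply_mono {T : OrderTensor (n + 1) ι} (hT : ∀ I, 0 ≤ T I) {c d : ι → ℝ}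
    (hc : ∀ i, 0 ≤ c i) (hcd : ∀ i, c i ≤ d i) (i : ι) : tensorApply T c i ≤ tensorApply T d i := by
  simp only [tensorApply_eq_sum_cons]
  exact Finset.sum_le_sum fun j _ => mul_le_mul_of_nonneg_left
    (Finset.prod_le_prod (fun _ _ => hc _) fun _ _ => hcd _) (hT _)

/-- If `c ≤ d`, then equality in `T c^{m-1} ≤ T d^{m-1}` at `i` spreads to all `b` linked with
`i`. -/
theorem eq_of_tensorApply_eq {T : OrderTensor (n + 1) ι} (hT : ∀ I, 0 ≤ T I)
    (hsymm : ∀ (I : Fin (n + 1) → ι) (σ : Equiv.Perm (Fin (n + 1))), T (I ∘ σ) = T I)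
    {c d : ι → ℝ} (hc : ∀ i, 0 < c i) (hcd : ∀ i, c i ≤ d i) {i b : ι}
    (h : tensorApply T c i = tensorApply T d i) (hi : c i = d i) (hb : TensorLinked T i b) :
    c b = d b := by
  obtain ⟨I, hI, ⟨k, hk⟩, ⟨l, hl⟩⟩ := hb
  rcases eq_or_ne l k with rfl | hlk
  · rw [← hl, hk, hi]
  obtain ⟨p, hp⟩ := Fin.exists_succAbove_eq hlk
  -- Symmetry moves the occurrence of `i` to the front, so this positive entry appears in the sum
  -- for `tensorApply` at `i`.
  have hIcons : I = (Fin.cons i (k.removeNth I) : Fin (n + 1) → ι) ∘ k.cycleRange := by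
    rw [Fin.cons_comp_cycleRange, ← hk, Fin.insertNth_self_removeNth]
  rw [hIcons, hsymm] at hI
  simp only [tensorApply_eq_sum_cons] at h
  -- The sums agree and compare termwise, so each term agrees; a strict inequality at `b` would make
  -- the product for this entry strictly smaller.
  have hj := (Finset.sum_eq_sum_iff_of_le fun j _ => mul_le_mul_of_nonneg_left
    (Finset.prod_le_prod (fun l _ => (hc (j l)).le) fun l _ => hcd (j l))
    (hT (Fin.cons i j))).1 h (k.removeNth I) (Finset.mem_univ _)
  have hprod := mul_left_cancel₀ hI.ne' hj
  by_contra hne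
  have hlt : c b < d b := lt_of_le_of_ne (hcd b) hne
  refine hprod.not_lt (Finset.prod_lt_prod (fun _ _ => hc _) (fun _ _ => hcd _)
    ⟨p, Finset.mem_univ p, ?_⟩)
  rwa [Fin.removeNth_apply, hp, hl]

/-- The smallest multiple of `c` above `d` touches `d`. -/
theorem exists_smul_touching [Nonempty ι] {c d : ι → ℝ} (hc : ∀ i, 0 < c i)
    (hd : ∀ i, 0 < d i) :
    ∃ t : ℝ, 0 < t ∧ (∀ i, d i ≤ (t • c) i) ∧ ∃ i, d i = (t • c) i := by
  obtain ⟨i, hi⟩ := Finite.exists_max fun i => d i / c i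
  refine ⟨d i / c i, div_pos (hd i) (hc i), fun j => ?_, i, ?_⟩
  · exact (div_le_iff₀ (hc j)).1 (hi j)
  · exact (div_mul_cancel₀ _ (hc i).ne').symm

/-- Where `t • c ≥ d` touches `d`, monotonicity gives `mu * d i ^ n ≤ lam * (t * c i) ^ n = lam * d
i ^ n`. Exchanging `c` and `d` gives equality of eigenvalues. -/
theorem eigenvalue_le [Nonempty ι] {T : OrderTensor (n + 1) ι} (hT : ∀ I, 0 ≤ T I)
    {c d : ι → ℝ} (hc : ∀ i, 0 < c i) (hd : ∀ i, 0 < d i) {lam mu : ℝ}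
    (hlam : ∀ i, lam * c i ^ n = tensorApply T c i)
    (hmu : ∀ i, mu * d i ^ n = tensorApply T d i) : mu ≤ lam := by
  obtain ⟨t, ht, hle, i, hi⟩ := exists_smul_touching hc hd
  have h := tensorApply_mono hT (fun i => (hd i).le) hle i
  rw [tensorApply_smul, ← hlam, ← hmu, hi, Pi.smul_apply, smul_eq_mul, mul_pow] at h
  have hp : 0 < t ^ n * c i ^ n := mul_pos (pow_pos ht n) (pow_pos (hc i) n)
  exact le_of_mul_le_mul_right (by linarith) hp

/-- Positive eigenvectors of a connected symmetric nonnegative tensor are proportional. -/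
theorem IsHEC.exists_eq_smul [Nonempty ι] {T : OrderTensor (n + 1) ι} (hT : ∀ I, 0 ≤ T I)
    (hsymm : ∀ (I : Fin (n + 1) → ι) (σ : Equiv.Perm (Fin (n + 1))), T (I ∘ σ) = T I)
    (hconn : ∀ a b, Relation.ReflTransGen (TensorLinked T) a b) {c d : ι → ℝ}
    (hc : IsHEC T c) (hd : IsHEC T d) : ∃ t : ℝ, 0 < t ∧ d = t • c := by
  obtain ⟨hcpos, lam, -, hlam⟩ := hc
  obtain ⟨hdpos, mu, -, hmu⟩ := hd
  have heq : mu = lam := le_antisymm (eigenvalue_le hT hcpos hdpos hlam hmu)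
    (eigenvalue_le hT hdpos hcpos hmu hlam)
  obtain ⟨t, ht, hle, i, hi⟩ := exists_smul_touching hcpos hdpos
  refine ⟨t, ht, funext fun b => ?_⟩
  have hstep : ∀ a, d a = (t • c) a → tensorApply T d a = tensorApply T (t • c) a := by
    intro a ha
    have h1 : mu * d a ^ n = tensorApply T d a := hmu a
    have h2 : lam * c a ^ n = tensorApply T c a := hlam a
    rw [tensorApply_smul, ← h1, ← h2, ha, heq, Pi.smul_apply, smul_eq_mul, mul_pow]
    ring
  induction hconn i b with
  | refl => exact hi
  | tail _ hr ih => exact eq_of_tensorApply_eq hT hsymm hdpos hle (hstep _ ih) ih hr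

end NonnegativeTensor

/-! ### The uplifted tensor is symmetric, nonnegative and connected. -/

namespace MHypergraph

variable {α : Type*}

theorem card_upliftEdge {m : ℕ} {e : Multiset α} (he : e.card ≤ m) :
    (upliftEdge m e).card = m := by
  simp [upliftEdge, he]

theorem some_mem_upliftEdge {m : ℕ} {e : Multiset α} {a : α} (ha : a ∈ e) :
    some a ∈ upliftEdge m e :=
  Multiset.mem_add.2 (Or.inl (Multiset.mem_map_of_mem _ ha))

variable [DecidableEq α]

theorem indexMultiset_comp {β : Type*} {W : Finset β} {m : ℕ} (I : Fin m → W)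
    (σ : Equiv.Perm (Fin m)) : indexMultiset (I ∘ σ) = indexMultiset I := by
  have h : (Finset.univ : Finset (Fin m)).val.map σ = Finset.univ.val :=
    Multiset.map_univ_val_equiv σ
  unfold indexMultiset
  conv_rhs => rw [← h, Multiset.map_map]
  rfl

theorem exists_indexMultiset_eq {β : Type*} {W : Finset β} {m : ℕ} {s : Multiset β}
    (hs : s.card = m) (hW : ∀ a ∈ s, a ∈ W) : ∃ I : Fin m → W, indexMultiset I = s := by
  subst hs
  induction s using Quotient.inductionOn with
  | h L =>
    refine ⟨fun l => ⟨L.get l, hW _ (List.get_mem L l)⟩, ?_⟩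
    simp only [indexMultiset]
    change Multiset.map L.get Finset.univ.val = _
    rw [Fin.univ_val_map]
    simp

theorem mem_indexMultiset {β : Type*} {W : Finset β} {m : ℕ} {I : Fin m → W} {a : W} :
    (a : β) ∈ indexMultiset I ↔ ∃ k, I k = a := by
  simp only [indexMultiset, Multiset.mem_map, Finset.mem_val, Finset.mem_univ, true_and,
    Subtype.ext_iff]

theorem upliftTensor_comp (H : MHypergraph α) (w : ℕ → ℕ → ℝ) (m : ℕ)
    (I : Fin m → (H.uplift m).verts) (σ : Equiv.Perm (Fin m)) :
    H.upliftTensor w m (I ∘ σ) = H.upliftTensor w m I := by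
  simp only [upliftTensor, indexMultiset_comp]

theorem weight_nonneg {w : ℕ → ℕ → ℝ} (hw : w = linearWeight ∨ w = factorialWeight) (m s : ℕ) :
    0 ≤ w m s := by
  rcases hw with rfl | rfl
  · unfold linearWeight; positivity
  · unfold factorialWeight; positivity

theorem weight_pos {w : ℕ → ℕ → ℝ} (hw : w = linearWeight ∨ w = factorialWeight) (m : ℕ) {s : ℕ}
    (hs : 0 < s) : 0 < w m s := by
  rcases hw with rfl | rfl
  · unfold linearWeight; positivity
  · unfold factorialWeight; positivity

theorem upliftTensor_nonneg (H : MHypergraph α) {w : ℕ → ℕ → ℝ}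
    (hw : w = linearWeight ∨ w = factorialWeight) (m : ℕ) (I : Fin m → (H.uplift m).verts) :
    0 ≤ H.upliftTensor w m I := by
  unfold upliftTensor
  split_ifs
  exacts [zero_le_one, weight_nonneg hw _ _, le_rfl]

theorem upliftTensor_pos (H : MHypergraph α) {w : ℕ → ℕ → ℝ}
    (hw : w = linearWeight ∨ w = factorialWeight) {m : ℕ} {I : Fin m → (H.uplift m).verts}
    {e : Multiset α} (he : e ∈ H.edges) (hI : indexMultiset I = upliftEdge m e) :
    0 < H.upliftTensor w m I := by
  unfold upliftTensor
  split_ifs with h1 h2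
  · exact zero_lt_one
  -- `linearWeight` vanishes at `s = 0`, so `⋆` must be shown to occur. If it did not, nothing was
  -- added to `e`, and the first case of the tensor would apply.
  · refine weight_pos hw m (Multiset.count_pos.2 ?_)
    by_contra hnone
    refine h1 (Finset.mem_image.2 ⟨e, he, ?_⟩)
    rw [hI, upliftEdge] at hnone ⊢
    have : m - e.card = 0 := by
      by_contra h
      exact hnone (Multiset.mem_add.2 (Or.inr (Multiset.mem_replicate.2 ⟨h, rfl⟩)))
    simp [this]
  · exact absurd (Finset.mem_image.2 ⟨e, he, hI.symm⟩) h2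

theorem exists_upliftTensor_pos (H : MHypergraph α) {w : ℕ → ℕ → ℝ}
    (hw : w = linearWeight ∨ w = factorialWeight) {m : ℕ} {e : Multiset α} (he : e ∈ H.edges)
    (hem : e.card ≤ m) :
    ∃ I : Fin m → (H.uplift m).verts, 0 < H.upliftTensor w m I ∧
      indexMultiset I = upliftEdge m e := by
  obtain ⟨I, hI⟩ := exists_indexMultiset_eq (W := (H.uplift m).verts) (card_upliftEdge hem)
    ((H.uplift m).mem_verts _ (Finset.mem_image_of_mem _ he))
  exact ⟨I, H.upliftTensor_pos hw he hI, hI⟩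

theorem tensorLinked_upliftTensor (H : MHypergraph α) {w : ℕ → ℕ → ℝ}
    (hw : w = linearWeight ∨ w = factorialWeight) {m : ℕ} {e : Multiset α} (he : e ∈ H.edges)
    (hem : e.card ≤ m) {a b : (H.uplift m).verts} (ha : (a : Option α) ∈ upliftEdge m e)
    (hb : (b : Option α) ∈ upliftEdge m e) : TensorLinked (H.upliftTensor w m) a b := by
  obtain ⟨I, hI, hIe⟩ := H.exists_upliftTensor_pos hw he hem
  exact ⟨I, hI, mem_indexMultiset.1 (hIe ▸ ha), mem_indexMultiset.1 (hIe ▸ hb)⟩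

/-- Walks in `H` survive because each hyperedge lies inside its uplift. If `⋆` is present, it was
added to some hyperedge, which is nonempty and so ties `⋆` to a node of `H`. -/
theorem StronglyConnected.uplift {H : MHypergraph α} (hH : H.StronglyConnected) {m : ℕ}
    (hm : ∀ e ∈ H.edges, e.card ≤ m) {w : ℕ → ℕ → ℝ}
    (hw : w = linearWeight ∨ w = factorialWeight) (x y : (H.uplift m).verts) :
    Relation.ReflTransGen (TensorLinked (H.upliftTensor w m)) x y := by
  have hsome : ∀ u v : H.verts, Relation.ReflTransGen (TensorLinked (H.upliftTensor w m))
      ⟨some (u : α), H.some_mem_uplift_verts m u⟩ ⟨some (v : α), H.some_mem_uplift_verts m v⟩ := by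
    rintro ⟨u, hu⟩ ⟨v, hv⟩
    have h := hH.2 u hu v hv
    induction h with
    | refl => exact .refl
    | tail _ hr ih =>
      obtain ⟨e, he, ha, hb⟩ := hr
      exact (ih (H.mem_verts e he _ ha)).tail (H.tensorLinked_upliftTensor hw he (hm e he)
        (some_mem_upliftEdge ha) (some_mem_upliftEdge hb))
  have hnone : ∀ z : (H.uplift m).verts, ∃ v : H.verts,
      Relation.ReflTransGen (TensorLinked (H.upliftTensor w m)) z
        ⟨some (v : α), H.some_mem_uplift_verts m v⟩ ∧
      Relation.ReflTransGen (TensorLinked (H.upliftTensor w m))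
        ⟨some (v : α), H.some_mem_uplift_verts m v⟩ z := by
    rintro ⟨_ | v, hz⟩
    · have hlt : ∃ e ∈ H.edges, e.card < m := by
        by_contra h
        simp [MHypergraph.uplift, h] at hz
      obtain ⟨e, he, hem⟩ := hlt
      obtain ⟨a, ha⟩ := Multiset.exists_mem_of_ne_zero (H.edge_ne_zero e he)
      have hn : (none : Option α) ∈ upliftEdge m e :=
        Multiset.mem_add.2 (Or.inr (Multiset.mem_replicate.2 ⟨by omega, rfl⟩))
      have hl := H.tensorLinked_upliftTensor hw he hem.le (a := ⟨none, hz⟩)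
        (b := ⟨some a, H.some_mem_uplift_verts m ⟨a, H.mem_verts e he a ha⟩⟩) hn
        (some_mem_upliftEdge ha)
      exact ⟨⟨a, H.mem_verts e he a ha⟩, .single hl, .single hl.symm⟩
    · have hv : v ∈ H.verts := by
        unfold MHypergraph.uplift at hz
        dsimp only at hz
        split_ifs at hz <;> simpa using hz
      exact ⟨⟨v, hv⟩, .refl, .refl⟩
  obtain ⟨u, hu, -⟩ := hnone x
  obtain ⟨v, -, hv⟩ := hnone y
  exact (hu.trans (hsome u v)).trans hv

end MHypergraph

theorem mainTheorem1 {α : Type*} [DecidableEq α] (H : MHypergraph α)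
    (hH : H.StronglyConnected) (M : ℕ) (hM : H.IsMaxEdgeSize M) (m : ℕ) (hm : M ≤ m)
    (w : ℕ → ℕ → ℝ) (hw : w = linearWeight ∨ w = factorialWeight) :
    ∃ u : H.verts → ℝ, (∀ v, 0 < u v) ∧ H.IsUHEC w m u ∧
      ∀ u' : H.verts → ℝ, H.IsUHEC w m u' ↔ ∃ a : ℝ, 0 < a ∧ u' = a • u := by
  have hcard : ∀ e ∈ H.edges, e.card ≤ m := fun e he => (hM.2 ⟨e, he, rfl⟩).trans hm
  obtain ⟨e, he, -⟩ := hM.1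
  -- Hyperedges are nonempty, so `m ≥ 1` and the exponent `m - 1` is a genuine `n`.
  obtain ⟨n, rfl⟩ : ∃ n, m = n + 1 := Nat.exists_eq_succ_of_ne_zero
    ((Multiset.card_pos.2 (H.edge_ne_zero e he)).trans_le (hcard e he)).ne'
  have hT := H.upliftTensor_nonneg hw (n + 1)
  have hsymm := H.upliftTensor_comp w (n + 1)
  have hconn := hH.uplift hcard hw
  obtain ⟨I, hI, -⟩ := H.exists_upliftTensor_pos hw he (hcard e he)
  have : Nonempty (H.uplift (n + 1)).verts := ⟨I 0⟩
  obtain ⟨c, hc⟩ := exists_isHEC hT hsymm hconn ⟨I, hI⟩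
  refine ⟨fun v => c ⟨some (v : α), H.some_mem_uplift_verts _ v⟩, fun v => hc.1 _,
    ⟨c, hc, fun v => rfl⟩, fun u' => ⟨?_, ?_⟩⟩
  · rintro ⟨d, hd, hu'⟩
    -- Proportionality holds on the whole uplift, including `⋆`, and restricts to the nodes of `H`.
    obtain ⟨a, ha, rfl⟩ := hc.exists_eq_smul hT hsymm hconn hd
    exact ⟨a, ha, funext hu'⟩
  · rintro ⟨a, ha, rfl⟩
    exact ⟨a • c, hc.smul ha, fun v => rfl⟩
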